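/- Let $\mathbb{BC}=\{z+jw : z,w\in\mathbb C\}$ be the commutative ring of bicomplex numbers ($j^2=-1$, $ij=ji$) and let $e_1=\frac{1+ij}{2}$, $e_2=\frac{1-ij}{2}$, so that every $Z=z+jw\in\mathbb{BC}$ is uniquely $Z=e_1z_1+e_2z_2$ with $z_1=z-iw$, $z_2=z+iw\in\mathbb C$. Let $k=ij$ and let $\mathbb D=\{x+ky: x,y\in\mathbb R\}=\{e_1\alpha_1+e_2\alpha_2:\alpha_1,\alpha_2\in\mathbb R\}$ be the ring of hyperbolic numbers, $\mathbb D^+=\{e_1\alpha_1+e_2\alpha_2:\alpha_1,\alpha_2\ge 0\}$, with the partial order $\alpha\le'\beta$ if and only if $\beta-\alpha\in\mathbb D^+$; for $\alpha\in\mathbb D^+$ let $\alpha^{1/2}=e_1\sqrt{\alpha_1}+e_2\sqrt{\alpha_2}$. The hyperbolic modulus of $Z$ is $|Z|_k=e_1|z_1|+e_2|z_2|$. Let $\mathbb U_{\mathbb{BC}}=\{Z\in\mathbb{BC}: |z_1|<1,\ |z_2|<1\}$. A function $f:\mathbb U_{\mathbb{BC}}\to\mathbb{BC}$ is bicomplex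 holomorphic if at every $Z\in\mathbb U_{\mathbb{BC}}$ the limit of $(f(W)-f(Z))/(W-Z)$ exists in $\mathbb{BC}$ as $W\to Z$ with $W-Z$ invertible. The bicomplex Hardy space $H^2(\mathbb U_{\mathbb{BC}})$ consists of the bicomplex holomorphic functions $f(Z)=\sum_{n\ge0}a_nZ^n$ on $\mathbb U_{\mathbb{BC}}$, $a_n\in\mathbb{BC}$, for which $\sum_n|a_n|_k^2$ converges in $\mathbb D$, with the $\mathbb D$-valued norm $\|f\|_{\mathbb D}=\left(\sum_n|a_n|_k^2\right)^{1/2}$. Let $\Phi:\mathbb U_{\mathbb{BC}}\to\mathbb U_{\mathbb{BC}}$ be bicomplex holomorphic. Then $C_\Phi f=f\circ\Phi$ maps $H^2(\mathbb U_{\mathbb{BC}})$ into itself and is $\mathbb D$-bounded there (there is $M\in\mathbb D^+$ with $\|C_\Phi f\|_{\mathbb D}\le' M\|f\|_{\mathbb D}$ for all $f\in H^2(\mathbb U_{\mathbb{BC}})$), the supremum $$\|C_\Phi\|_{\mathbb D}=\sup\{\|C_\Phi f\|_{\mathbb D} : f\in H^2(\mathbb U_{\mathbb{BC}}),\ \|f\|_{\mathbb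 D}\le' 1\}$$ with respect to $\le'$ exists in $\mathbb D$, and $$\left(\frac{1}{1-|\Phi(0)|_k^2}\right)^{1/2}\le'\|C_\Phi\|_{\mathbb D}\le'\left(\frac{1+|\Phi(0)|_k}{1-|\Phi(0)|_k}\right)^{1/2}.$$ -/

import Mathlib

open scoped Topology Ring

namespace Bicomplex

noncomputable section

/-! ## Bicomplex and hyperbolic numbers -/

/-- The ring of bicomplex numbers `Z = z + j w`, with `z, w ∈ ℂ(i)` and `j ^ 2 = -1`;
`z = Z.re` and `w = Z.im`. -/
abbrev BC : Type := QuadraticAlgebra ℂ (-1) 0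

/-- The ring of hyperbolic numbers `α = x + k y`, with `x, y ∈ ℝ` and `k ^ 2 = 1`;
`x = α.re` and `y = α.im`. -/
abbrev Hyp : Type := QuadraticAlgebra ℝ 1 0

/-- The Euclidean topology of the bicomplex numbers. -/
instance : TopologicalSpace BC :=
  TopologicalSpace.induced (QuadraticAlgebra.equivProd (-1 : ℂ) 0) inferInstance

/-- The Euclidean topology of the hyperbolic numbers. -/
instance : TopologicalSpace Hyp :=
  TopologicalSpace.induced (QuadraticAlgebra.equivProd (1 : ℝ) 0) inferInstance

/-- The first idempotent component `z₁ = z - i w` of `Z = z + j w = e₁ z₁ + e₂ z₂`, where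
`e₁ = (1 + i j) / 2` and `e₂ = (1 - i j) / 2`. -/
def comp₁ : BC →+* ℂ where
  toFun Z := Z.re - Complex.I * Z.im
  map_one' := by rw [QuadraticAlgebra.re_one, QuadraticAlgebra.im_one]; simp
  map_zero' := by simp
  map_add' Z W := by simp; ring
  map_mul' Z W := by
    simp only [QuadraticAlgebra.re_mul, QuadraticAlgebra.im_mul]
    linear_combination (-Z.im * W.im) * Complex.I_sq

/-- The second idempotent component `z₂ = z + i w` of `Z = z + j w = e₁ z₁ + e₂ z₂`. -/
def comp₂ : BC →+* ℂ where
  toFun Z := Z.re + Complex.I * Z.im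
  map_one' := by rw [QuadraticAlgebra.re_one, QuadraticAlgebra.im_one]; simp
  map_zero' := by simp
  map_add' Z W := by simp; ring
  map_mul' Z W := by
    simp only [QuadraticAlgebra.re_mul, QuadraticAlgebra.im_mul]
    linear_combination (-Z.im * W.im) * Complex.I_sq

/-- The idempotent `e₁ = (1 + i j) / 2`. -/
def e₁ : BC := ⟨1 / 2, Complex.I / 2⟩

/-- The idempotent `e₂ = (1 - i j) / 2`. -/
def e₂ : BC := ⟨1 / 2, -Complex.I / 2⟩

theorem idempotent_representation (Z : BC) :
    Z = e₁ * algebraMap ℂ BC (comp₁ Z) + e₂ * algebraMap ℂ BC (comp₂ Z) := by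
  ext
  · simp [e₁, e₂, comp₁, comp₂, QuadraticAlgebra.algebraMap_eq]; ring
  · simp [e₁, e₂, comp₁, comp₂, QuadraticAlgebra.algebraMap_eq]
    linear_combination (Z.im) * Complex.I_sq

namespace Hyp

/-- The first idempotent component `α₁ = x + y` of `α = x + k y = e₁ α₁ + e₂ α₂`. -/
def fst (α : Hyp) : ℝ := α.re + α.im

/-- The second idempotent component `α₂ = x - y` of `α = x + k y = e₁ α₁ + e₂ α₂`. -/
def snd (α : Hyp) : ℝ := α.re - α.im

/-- The hyperbolic number `e₁ a + e₂ b`, where `e₁ = (1 + k) / 2` and `e₂ = (1 - k) / 2`. -/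
def ofIdem (a b : ℝ) : Hyp := ⟨(a + b) / 2, (a - b) / 2⟩

theorem fst_ofIdem (a b : ℝ) : (ofIdem a b).fst = a := by simp [fst, ofIdem]; ring

theorem snd_ofIdem (a b : ℝ) : (ofIdem a b).snd = b := by simp [snd, ofIdem]; ring

theorem ext_idem {α β : Hyp} (h₁ : α.fst = β.fst) (h₂ : α.snd = β.snd) : α = β := by
  simp only [fst, snd] at h₁ h₂
  ext <;> linarith

/-- The order `≤'` of the hyperbolic numbers: `α ≤' β` if and only if `β - α` lies in
`𝔻⁺ = {e₁ α₁ + e₂ α₂ | α₁, α₂ ≥ 0}`. -/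
instance : PartialOrder Hyp where
  le α β := 0 ≤ (β - α).fst ∧ 0 ≤ (β - α).snd
  le_refl α := by simp [fst, snd]
  le_trans α β γ h h' := by
    simp only [fst, snd, QuadraticAlgebra.re_sub, QuadraticAlgebra.im_sub] at *
    constructor <;> linarith [h.1, h.2, h'.1, h'.2]
  le_antisymm α β h h' := by
    simp only [fst, snd, QuadraticAlgebra.re_sub, QuadraticAlgebra.im_sub] at *
    ext <;> linarith [h.1, h.2, h'.1, h'.2]

/-- The square root in `𝔻⁺` of a hyperbolic number in `𝔻⁺`. -/
def sqrt (α : Hyp) : Hyp := ofIdem (Real.sqrt α.fst) (Real.sqrt α.snd)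

theorem sqrt_sq {α : Hyp} (hα : 0 ≤ α) : sqrt α ^ 2 = α := by
  have h₁ : 0 ≤ α.fst := by simpa using hα.1
  have h₂ : 0 ≤ α.snd := by simpa using hα.2
  apply ext_idem
  · have := Real.mul_self_sqrt h₁
    simp only [fst, sqrt, ofIdem, pow_two, QuadraticAlgebra.re_mul, QuadraticAlgebra.im_mul] at *
    linarith
  · have := Real.mul_self_sqrt h₂
    simp only [snd, sqrt, ofIdem, pow_two, QuadraticAlgebra.re_mul, QuadraticAlgebra.im_mul] at *
    linarith

/-- The inclusion of the hyperbolic numbers in the bicomplex numbers, with `k = i j`. -/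
def toBC : Hyp →+* BC where
  toFun α := ⟨α.re, Complex.I * α.im⟩
  map_one' := by ext <;> simp [QuadraticAlgebra.re_one, QuadraticAlgebra.im_one]
  map_zero' := by ext <;> simp
  map_add' α β := by ext <;> simp; ring
  map_mul' α β := by
    ext
    · simp only [QuadraticAlgebra.re_mul]
      push_cast
      linear_combination (-(α.im : ℂ) * β.im) * -Complex.I_sq
    · simp only [QuadraticAlgebra.im_mul]
      push_cast
      ring

end Hyp

/-- The conjugation `Z^{†₃} = z̄ - j w̄` of `Z = z + j w`. -/
def dagger₃ (Z : BC) : BC := ⟨starRingEnd ℂ Z.re, -starRingEnd ℂ Z.im⟩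

/-- The hyperbolic modulus `|Z|_k = e₁ |z₁| + e₂ |z₂|` of `Z = e₁ z₁ + e₂ z₂`. -/
def hypMod (Z : BC) : Hyp := Hyp.ofIdem ‖comp₁ Z‖ ‖comp₂ Z‖

theorem hypMod_sq (Z : BC) : Hyp.toBC (hypMod Z ^ 2) = Z * dagger₃ Z := by
  have h₁ := Complex.mul_conj' (comp₁ Z)
  have h₂ := Complex.mul_conj' (comp₂ Z)
  simp only [comp₁, comp₂, RingHom.coe_mk, MonoidHom.coe_mk, OneHom.coe_mk, map_add, map_sub,
    map_mul, Complex.conj_I] at h₁ h₂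
  ext
  · simp [Hyp.toBC, hypMod, Hyp.ofIdem, dagger₃, pow_two, comp₁, comp₂]
    linear_combination (-1 / 2) * h₁ + (-1 / 2) * h₂ -
      (Z.im * starRingEnd ℂ Z.im) * Complex.I_sq
  · simp [Hyp.toBC, hypMod, Hyp.ofIdem, dagger₃, pow_two, comp₁, comp₂]
    linear_combination (-Complex.I / 2) * h₁ + (Complex.I / 2) * h₂ +
      (Z.re * starRingEnd ℂ Z.im - Z.im * starRingEnd ℂ Z.re) * Complex.I_sq

/-! ## Bicomplex holomorphic functions -/

/-- The bicomplex number `c` is the bicomplex derivative of `f : Ω → BC` at `Z`: it is the limit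
of `(f W - f Z) / (W - Z)` as `W → Z` in `Ω` with `W - Z` invertible, that is, with `W - Z`
neither zero nor a zero divisor. -/
def HasBCDerivAt {Ω : Set BC} (f : Ω → BC) (c : BC) (Z : Ω) : Prop :=
  Filter.Tendsto (fun W : Ω => (f W - f Z) * ((W : BC) - (Z : BC))⁻¹ʳ)
    (𝓝[{W : Ω | IsUnit ((W : BC) - (Z : BC))}] Z) (𝓝 c)

/-- A function is bicomplex holomorphic on `Ω` if it has a bicomplex derivative at each point. -/
def IsBCHolomorphic {Ω : Set BC} (f : Ω → BC) : Prop :=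
  ∀ Z : Ω, ∃ c : BC, HasBCDerivAt f c Z

/-- The unit disc `{Z = e₁ z₁ + e₂ z₂ | |z₁| < 1, |z₂| < 1}` of the bicomplex numbers. -/
def unitDisc : Set BC := {Z | ‖comp₁ Z‖ < 1 ∧ ‖comp₂ Z‖ < 1}

/-- The centre of the unit disc. -/
instance : Zero unitDisc := ⟨⟨0, by simp [unitDisc]⟩⟩

/-! ## The bicomplex Hardy space -/

/-- The power series `∑ aₙ Zⁿ` with bicomplex coefficients converges to `f` on the unit disc. -/
def HasCoeffs (f : unitDisc → BC) (a : ℕ → BC) : Prop :=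
  ∀ Z : unitDisc, HasSum (fun n => a n * (Z : BC) ^ n) (f Z)

theorem continuous_comp₁ : Continuous comp₁ := by
  have h : Continuous (QuadraticAlgebra.equivProd (-1 : ℂ) 0) := continuous_induced_dom
  exact h.fst.sub (continuous_const.mul h.snd)

theorem continuous_comp₂ : Continuous comp₂ := by
  have h : Continuous (QuadraticAlgebra.equivProd (-1 : ℂ) 0) := continuous_induced_dom
  exact h.fst.add (continuous_const.mul h.snd)

theorem coeff_eq_of_hasSum {g : ℂ → ℂ} {a b : ℕ → ℂ}
    (ha : ∀ z : ℂ, ‖z‖ < 1 → HasSum (fun n => a n * z ^ n) (g z))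
    (hb : ∀ z : ℂ, ‖z‖ < 1 → HasSum (fun n => b n * z ^ n) (g z)) : a = b := by
  have key : ∀ c : ℕ → ℂ, (∀ z : ℂ, ‖z‖ < 1 → HasSum (fun n => c n * z ^ n) (g z)) →
      HasFPowerSeriesAt g (FormalMultilinearSeries.ofScalars ℂ c) 0 := by
    intro c hc
    rw [hasFPowerSeriesAt_iff]
    filter_upwards [Metric.ball_mem_nhds (0 : ℂ) one_pos] with z hz
    have := hc z (by simpa using hz)
    simpa [FormalMultilinearSeries.coeff_ofScalars, mul_comm] using this
  have h := (key a ha).eq_formalMultilinearSeries (key b hb)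
  funext n
  have := congrArg (fun p => FormalMultilinearSeries.coeff p n) h
  simpa [FormalMultilinearSeries.coeff_ofScalars] using this

/-- The power series coefficients of a function on the unit disc are unique. -/
theorem HasCoeffs.unique {f : unitDisc → BC} {a b : ℕ → BC} (ha : HasCoeffs f a)
    (hb : HasCoeffs f b) : a = b := by
  have key : ∀ z : ℂ, ‖z‖ < 1 → (algebraMap ℂ BC z) ∈ unitDisc := by
    intro z hz
    simpa [unitDisc, comp₁, comp₂, QuadraticAlgebra.algebraMap_eq] using hz
  have c₁ : ∀ z : ℂ, comp₁ (algebraMap ℂ BC z) = z := by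
    intro z; simp [comp₁, QuadraticAlgebra.algebraMap_eq]
  have c₂ : ∀ z : ℂ, comp₂ (algebraMap ℂ BC z) = z := by
    intro z; simp [comp₂, QuadraticAlgebra.algebraMap_eq]
  classical
  let ext : ℂ → BC := fun z => if h : ‖z‖ < 1 then f ⟨algebraMap ℂ BC z, key z h⟩ else 0
  have s₁ : ∀ c, HasCoeffs f c → ∀ z : ℂ, ‖z‖ < 1 →
      HasSum (fun n => comp₁ (c n) * z ^ n) (comp₁ (ext z)) := by
    intro c hc z hz
    have := (hc ⟨algebraMap ℂ BC z, key z hz⟩).map comp₁ continuous_comp₁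
    simpa [Function.comp_def, c₁, ext, hz] using this
  have s₂ : ∀ c, HasCoeffs f c → ∀ z : ℂ, ‖z‖ < 1 →
      HasSum (fun n => comp₂ (c n) * z ^ n) (comp₂ (ext z)) := by
    intro c hc z hz
    have := (hc ⟨algebraMap ℂ BC z, key z hz⟩).map comp₂ continuous_comp₂
    simpa [Function.comp_def, c₂, ext, hz] using this
  have h₁ := coeff_eq_of_hasSum (s₁ a ha) (s₁ b hb)
  have h₂ := coeff_eq_of_hasSum (s₂ a ha) (s₂ b hb)
  funext n
  rw [idempotent_representation (a n), idempotent_representation (b n), congrFun h₁ n,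
    congrFun h₂ n]

/-- The power series coefficients of `f` (zero if `f` has no power series expansion). -/
def coeff (f : unitDisc → BC) : ℕ → BC :=
  open Classical in if h : ∃ a, HasCoeffs f a then h.choose else 0

/-- The bicomplex Hardy space `H²`: the bicomplex holomorphic functions on the unit disc whose
sequence of power series coefficients is square-summable. -/
def H2 : Set (unitDisc → BC) :=
  {f | IsBCHolomorphic f ∧ HasCoeffs f (coeff f) ∧ Summable fun n => hypMod (coeff f n) ^ 2}

/-- The `𝔻`-valued norm of `H²`, `‖∑ aₙ Zⁿ‖_𝔻 = (∑ |aₙ|_k²)^{1/2}`. -/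
def normH2 (f : unitDisc → BC) : Hyp := Hyp.sqrt (∑' n, hypMod (coeff f n) ^ 2)

/-! ## Operators on the bicomplex Hardy space -/

/-- The composition operator `C_Φ f = f ∘ Φ`, as a `BC`-linear map. -/
def compOp (Φ : unitDisc → unitDisc) : (unitDisc → BC) →ₗ[BC] (unitDisc → BC) :=
  LinearMap.funLeft BC BC Φ

/-- `T` is a `𝔻`-bounded operator from `H²` into itself. -/
def IsDBounded (T : (unitDisc → BC) →ₗ[BC] (unitDisc → BC)) : Prop :=
  (∀ f ∈ H2, T f ∈ H2) ∧ ∃ M : Hyp, 0 ≤ M ∧ ∀ f ∈ H2, normH2 (T f) ≤ M * normH2 f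

/-- `N` is the operator `𝔻`-norm of `T` on `H²`, namely the supremum with respect to `≤'` of
`‖T f‖_𝔻` over the `f ∈ H²` with `‖f‖_𝔻 ≤' 1`. -/
def IsOpDNorm (T : (unitDisc → BC) →ₗ[BC] (unitDisc → BC)) (N : Hyp) : Prop :=
  IsLUB {α : Hyp | ∃ f ∈ H2, normH2 f ≤ 1 ∧ α = normH2 (T f)} N

end

end Bicomplex

namespace Bicomplex

noncomputable section

open Metric Filter Real

/-! ## Littlewood subordination in one complex variable -/

/-! Everything decouples along the idempotents. `W - Z` is invertible exactly when both its
components are nonzero, so the bicomplex difference quotient is a pair of scalar quotients, and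
holomorphy makes each component of `f` a holomorphic function of the matching component of `Z` alone
(`IsBCHolomorphic.exists_hasComps`). The delicate point is that the limit avoids the cross where
either component of `W - Z` vanishes, so independence of the other variable has to be drawn from
limits off that cross. Coefficients, norm, order and suprema split as well, which reduces the claim
to two classical composition operators with symbols `φ₁`, `φ₂`.

The upper bound is Littlewood subordination. A polynomial `p` has an explicit harmonic majorant of
`|p|²` on the disc, the real part of `majorant`. Composed with `φ` it stays harmonic, so its circle
means equal its value at `φ 0`, which a Harnack-type estimate (`re_majorant_le`) bounds by `(1 + |φ
0|) / (1 - |φ 0|)` times the sum of the squared coefficients. Passing from polynomials to power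
series, and from circle means to coefficients by Bessel's inequality, gives
`littlewood_subordination`.

For the lower bound, the constant coefficient of `g ∘ φ` is `g (φ 0)`, so its norm is at least `|g
(φ 0)|`. The normalised reproducing kernel at `φ 0` (`normalized_kernel`) makes this value `(1 - |φ
0|²)^{-1/2}`. -/

/-- The partial sum `∑_{n < N} aₙ zⁿ`, in Horner form. -/
def horner : ℕ → (ℕ → ℂ) → ℂ → ℂ
  | 0, _, _ => 0
  | N + 1, a, z => a 0 + z * horner N (fun n => a (n + 1)) z

/-- A polynomial whose real part is a harmonic majorant of `‖horner N a‖ ^ 2` on the unit disc. -/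
def majorant : ℕ → (ℕ → ℂ) → ℂ → ℂ
  | 0, _, _ => 0
  | N + 1, a, z => ((‖a 0‖ ^ 2 : ℝ) : ℂ) +
      2 * (starRingEnd ℂ (a 0) * (z * horner N (fun n => a (n + 1)) z)) +
      majorant N (fun n => a (n + 1)) z

theorem horner_eq_sum (N : ℕ) (a : ℕ → ℂ) (z : ℂ) :
    horner N a z = ∑ n ∈ Finset.range N, a n * z ^ n := by
  induction N generalizing a with
  | zero => simp [horner]
  | succ N ih =>
    rw [horner, ih, Finset.sum_range_succ', Finset.mul_sum, add_comm]
    simp only [pow_zero, mul_one]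
    congr 1
    exact Finset.sum_congr rfl fun n _ => by ring

theorem differentiable_horner (N : ℕ) (a : ℕ → ℂ) : Differentiable ℂ (horner N a) := by
  have : horner N a = fun z => ∑ n ∈ Finset.range N, a n * z ^ n := funext (horner_eq_sum N a)
  rw [this]
  fun_prop

theorem differentiable_majorant (N : ℕ) (a : ℕ → ℂ) : Differentiable ℂ (majorant N a) := by
  induction N generalizing a with
  | zero => exact differentiable_const 0
  | succ N ih =>
    have h := differentiable_horner N fun n => a (n + 1)
    exact (((differentiable_const _).add (((differentiable_id.mul h).const_mul _).const_mul _))).add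
      (ih _)

theorem norm_add_sq_complex (x y : ℂ) :
    ‖x + y‖ ^ 2 = ‖x‖ ^ 2 + (2 * (starRingEnd ℂ x * y)).re + ‖y‖ ^ 2 := by
  simp only [Complex.sq_norm, Complex.normSq_apply, Complex.add_re, Complex.add_im, Complex.mul_re,
    Complex.mul_im, Complex.conj_re, Complex.conj_im, Complex.re_ofNat, Complex.im_ofNat]
  ring

/-- Expanding `|a₀ + z p|²` leaves `|z|² |p|²`, and the majorant replaces the factor `|z|²` by `1`
at every stage; on the unit circle nothing is lost. -/
theorem norm_horner_sq_le (N : ℕ) (a : ℕ → ℂ) {z : ℂ} (hz : ‖z‖ ≤ 1) :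
    ‖horner N a z‖ ^ 2 ≤ (majorant N a z).re := by
  induction N generalizing a with
  | zero => simp [horner, majorant]
  | succ N ih =>
    rw [horner, majorant, norm_add_sq_complex, Complex.add_re, Complex.add_re, Complex.ofReal_re,
      norm_mul, mul_pow]
    have h₁ : ‖z‖ ^ 2 ≤ 1 := pow_le_one₀ (norm_nonneg z) hz
    have := mul_le_of_le_one_left (sq_nonneg ‖horner N (fun n => a (n + 1)) z‖) h₁
    linarith [ih fun n => a (n + 1)]

/-- Harnack's inequality for the majorant, proved algebraically. The extra term `‖z‖ * ‖horner N a
z‖ ^ 2` strengthens the induction: it absorbs the cross term of the next stage. -/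
theorem re_majorant_le_aux (N : ℕ) (a : ℕ → ℂ) {z : ℂ} (hz : ‖z‖ < 1) :
    (majorant N a z).re + ‖z‖ * ‖horner N a z‖ ^ 2 ≤
      (1 + ‖z‖) / (1 - ‖z‖) * ∑ n ∈ Finset.range N, ‖a n‖ ^ 2 := by
  induction N generalizing a with
  | zero => simp [horner, majorant]
  | succ N ih =>
    have ih := ih fun n => a (n + 1)
    rw [horner, majorant, norm_add_sq_complex, Complex.add_re, Complex.add_re, Complex.ofReal_re,
      norm_mul, Finset.sum_range_succ', mul_add]
    set p := horner N (fun n => a (n + 1)) z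
    set S := (1 + ‖z‖) / (1 - ‖z‖) * ∑ n ∈ Finset.range N, ‖a (n + 1)‖ ^ 2
    have hc : (2 * (starRingEnd ℂ (a 0) * (z * p))).re ≤ 2 * (‖a 0‖ * (‖z‖ * ‖p‖)) := by
      refine (Complex.re_le_norm _).trans_eq ?_
      simp
    set t := ‖z‖
    have ht : 0 ≤ t := norm_nonneg z
    have h1t : 0 < 1 - t := by linarith
    have hc' := mul_le_mul_of_nonneg_left hc (by linarith : 0 ≤ 1 + t)
    -- This is what remains once the induction hypothesis is subtracted; the two sides differ by a
    -- nonnegative multiple of a perfect square.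
    have key : ‖a 0‖ ^ 2 * (1 + t) + (1 + t) * (2 * (‖a 0‖ * (t * ‖p‖))) + t * (t * ‖p‖) ^ 2 ≤
        (1 + t) / (1 - t) * ‖a 0‖ ^ 2 + t * ‖p‖ ^ 2 := by
      have e : (1 + t) / (1 - t) * ‖a 0‖ ^ 2 + t * ‖p‖ ^ 2 - (‖a 0‖ ^ 2 * (1 + t) +
          (1 + t) * (2 * (‖a 0‖ * (t * ‖p‖))) + t * (t * ‖p‖) ^ 2) =
          t * (1 + t) / (1 - t) * (‖a 0‖ - (1 - t) * ‖p‖) ^ 2 := by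
        field_simp
        ring
      have : 0 ≤ t * (1 + t) / (1 - t) * (‖a 0‖ - (1 - t) * ‖p‖) ^ 2 := by positivity
      linarith
    nlinarith

theorem re_majorant_le (N : ℕ) (a : ℕ → ℂ) {z : ℂ} (hz : ‖z‖ < 1) :
    (majorant N a z).re ≤ (1 + ‖z‖) / (1 - ‖z‖) * ∑ n ∈ Finset.range N, ‖a n‖ ^ 2 := by
  have := re_majorant_le_aux N a hz
  have : 0 ≤ ‖z‖ * ‖horner N a z‖ ^ 2 := by positivity
  linarith

theorem summable_norm_of_hasSum {a : ℕ → ℂ} {F : ℂ → ℂ}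
    (h : ∀ z : ℂ, ‖z‖ < 1 → HasSum (fun n => a n * z ^ n) (F z)) {r : ℝ} (h0 : 0 ≤ r) (h1 : r < 1) :
    Summable fun n => ‖a n‖ * r ^ n := by
  have := (h r (by simpa [abs_of_nonneg h0] using h1)).summable.norm
  simpa [abs_of_nonneg h0] using this

/-- Absolute convergence at a radius `r` between `‖z‖` and `1` dominates the series on the ball of
radius `r`. -/
theorem differentiableOn_of_hasSum {a : ℕ → ℂ} {F : ℂ → ℂ}
    (h : ∀ z : ℂ, ‖z‖ < 1 → HasSum (fun n => a n * z ^ n) (F z)) :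
    DifferentiableOn ℂ F (ball 0 1) := by
  intro z hz
  rw [mem_ball_zero_iff] at hz
  obtain ⟨r, hr, hr1⟩ := exists_between hz
  have hr0 := (norm_nonneg z).trans_lt hr
  have hd : DifferentiableOn ℂ (fun w => ∑' n, a n * w ^ n) (ball 0 r) := by
    refine Complex.differentiableOn_tsum_of_summable_norm (summable_norm_of_hasSum h hr0.le hr1)
      (fun n => by fun_prop) isOpen_ball fun n w hw => ?_
    rw [mem_ball_zero_iff] at hw
    rw [norm_mul, norm_pow]
    gcongr
  have hz' : ball (0 : ℂ) r ∈ 𝓝 z := isOpen_ball.mem_nhds (by simpa using hr)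
  refine ((hd.differentiableAt hz').congr_of_eventuallyEq ?_).differentiableWithinAt
  filter_upwards [hz'] with w hw
  rw [mem_ball_zero_iff] at hw
  exact (h w (hw.trans hr1)).tsum_eq.symm

theorem circleIntegrable_of_continuousOn_ball {E : Type*} [NormedAddCommGroup E] {F : ℂ → E}
    (hF : ContinuousOn F (ball 0 1)) {r : ℝ} (h0 : 0 ≤ r) (h1 : r < 1) :
    CircleIntegrable F 0 r :=
  (hF.mono fun z hz => by
    rw [mem_sphere_zero_iff_norm] at hz
    simpa [hz] using h1).circleIntegrable h0

theorem circleAverage_re_of_differentiableOn {F : ℂ → ℂ} (hF : DifferentiableOn ℂ F (ball 0 1))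
    {r : ℝ} (h0 : 0 ≤ r) (h1 : r < 1) : circleAverage (fun z => (F z).re) 0 r = (F 0).re := by
  have hc : DiffContOnCl ℂ F (ball 0 |r|) := by
    refine (hF.mono ?_).diffContOnCl
    refine closure_ball_subset_closedBall.trans fun z hz => ?_
    rw [mem_closedBall_zero_iff, abs_of_nonneg h0] at hz
    simpa using hz.trans_lt h1
  have := Complex.reCLM.circleAverage_comp_comm
    (circleIntegrable_of_continuousOn_ball hF.continuousOn h0 h1)
  rw [hc.circleAverage] at this
  exact this

/-- Bessel's inequality for the Taylor coefficients, on the circle of radius `r`. -/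
theorem sum_norm_coeff_sq_le_circleAverage (K : ℕ) {b : ℕ → ℂ} {F : ℂ → ℂ}
    (h : ∀ z : ℂ, ‖z‖ < 1 → HasSum (fun n => b n * z ^ n) (F z)) {r : ℝ} (h0 : 0 < r) (h1 : r < 1) :
    ∑ n ∈ Finset.range K, ‖b n‖ ^ 2 * (r ^ 2) ^ n ≤ circleAverage (fun z => ‖F z‖ ^ 2) 0 r := by
  induction K generalizing b F with
  | zero => simpa using circleAverage_nonneg_of_nonneg fun z _ => sq_nonneg ‖F z‖
  | succ K ih =>
    have hs : ∀ z : ℂ, ‖z‖ < 1 → Summable fun n => b (n + 1) * z ^ n := by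
      intro z hz
      -- The shifted series comes from dividing by `z`, so the origin needs its own argument.
      rcases eq_or_ne z 0 with rfl | hz0
      · exact summable_of_ne_finset_zero (s := {0}) fun n hn => by
          simp [show n ≠ 0 by simpa using hn]
      · have := ((summable_nat_add_iff 1).2 (h z hz).summable).mul_right z⁻¹
        refine this.congr fun n => ?_
        rw [pow_succ, mul_assoc, mul_assoc, mul_inv_cancel₀ hz0, mul_one]
    set R : ℂ → ℂ := fun z => ∑' n, b (n + 1) * z ^ n with hR
    have hRs : ∀ z : ℂ, ‖z‖ < 1 → HasSum (fun n => b (n + 1) * z ^ n) (R z) :=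
      fun z hz => (hs z hz).hasSum
    have hFR : ∀ z : ℂ, ‖z‖ < 1 → F z = b 0 + z * R z := by
      intro z hz
      refine (h z hz).unique ?_
      rw [← hasSum_nat_add_iff' 1]
      simp only [Finset.sum_range_one, pow_zero, mul_one, add_sub_cancel_left]
      exact ((hRs z hz).mul_left z).congr_fun fun n => by ring
    have hRd := differentiableOn_of_hasSum hRs
    have hGd : DifferentiableOn ℂ (fun z => 2 * (starRingEnd ℂ (b 0) * (z * R z))) (ball 0 1) :=
      ((differentiableOn_id.mul hRd).const_mul _).const_mul _
    -- Peeling off `b 0` gives `F = b 0 + z R`; the cross term is the real part of a holomorphic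
    -- function vanishing at `0`, so its mean is zero.
    have e : circleAverage (fun z => ‖F z‖ ^ 2) 0 r = circleAverage (fun z => (‖b 0‖ ^ 2 +
        (2 * (starRingEnd ℂ (b 0) * (z * R z))).re) + r ^ 2 • ‖R z‖ ^ 2) 0 r := by
      refine circleAverage_congr_sphere fun z hz => ?_
      rw [mem_sphere_zero_iff_norm, abs_of_pos h0] at hz
      rw [hFR z (hz ▸ h1), norm_add_sq_complex, norm_mul, hz, mul_pow, smul_eq_mul]
    have i₁ : CircleIntegrable (fun z => (2 * (starRingEnd ℂ (b 0) * (z * R z))).re) 0 r :=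
      circleIntegrable_of_continuousOn_ball
      (Complex.continuous_re.comp_continuousOn hGd.continuousOn) h0.le h1
    have i₂ : CircleIntegrable (fun z => r ^ 2 • ‖R z‖ ^ 2) 0 r := circleIntegrable_of_continuousOn_ball
      ((hRd.continuousOn.norm.pow 2).const_smul (r ^ 2)) h0.le h1
    have i₃ : CircleIntegrable (fun _ => ‖b 0‖ ^ 2) (0 : ℂ) r := circleIntegrable_const _ _ _
    have i₄ : CircleIntegrable
        (fun z => ‖b 0‖ ^ 2 + (2 * (starRingEnd ℂ (b 0) * (z * R z))).re) 0 r := i₃.add i₁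
    rw [e, circleAverage_fun_add i₄ i₂, circleAverage_fun_add i₃ i₁, circleAverage_const,
      circleAverage_re_of_differentiableOn hGd h0.le h1, circleAverage_fun_smul,
      Finset.sum_range_succ']
    have := mul_le_mul_of_nonneg_left (ih hRs) (sq_nonneg r)
    rw [Finset.mul_sum] at this
    simp only [zero_mul, mul_zero, Complex.zero_re, add_zero, pow_zero, mul_one, smul_eq_mul]
    rw [add_comm]
    refine add_le_add_right (le_trans (le_of_eq ?_) this) _
    exact Finset.sum_congr rfl fun n _ => by ring

/-- For each partial sum, the majorant composed with `φ` obeys the mean value property; the bound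
does not depend on `N` and survives the limit. -/
theorem circleAverage_norm_comp_sq_le {a : ℕ → ℂ} {f φ : ℂ → ℂ}
    (ha : ∀ z : ℂ, ‖z‖ < 1 → HasSum (fun n => a n * z ^ n) (f z)) (h2 : Summable fun n => ‖a n‖ ^ 2)
    (hφ : DifferentiableOn ℂ φ (ball 0 1)) (hφ1 : ∀ z : ℂ, ‖z‖ < 1 → ‖φ z‖ < 1)
    {r : ℝ} (h0 : 0 < r) (h1 : r < 1) :
    circleAverage (fun z => ‖f (φ z)‖ ^ 2) 0 r ≤
      (1 + ‖φ 0‖) / (1 - ‖φ 0‖) * ∑' n, ‖a n‖ ^ 2 := by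
  have hφm : Set.MapsTo φ (ball 0 1) (ball 0 1) := fun z hz => by
    simpa using hφ1 z (by simpa using hz)
  have hφ0 : ‖φ 0‖ < 1 := hφ1 0 (by simp)
  have bound : ∀ N, circleAverage (fun z => ‖horner N a (φ z)‖ ^ 2) 0 r ≤
      (1 + ‖φ 0‖) / (1 - ‖φ 0‖) * ∑' n, ‖a n‖ ^ 2 := by
    intro N
    have hg := (differentiable_majorant N a).comp_differentiableOn hφ
    have hp := (differentiable_horner N a).comp_differentiableOn hφ
    calc circleAverage (fun z => ‖horner N a (φ z)‖ ^ 2) 0 r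
        ≤ circleAverage (fun z => (majorant N a (φ z)).re) 0 r := by
          refine circleAverage_mono
            (circleIntegrable_of_continuousOn_ball (hp.continuousOn.norm.pow 2) h0.le h1)
            (circleIntegrable_of_continuousOn_ball
              (Complex.continuous_re.comp_continuousOn hg.continuousOn) h0.le h1) fun z hz => ?_
          rw [mem_sphere_zero_iff_norm, abs_of_pos h0] at hz
          exact norm_horner_sq_le N a (hφ1 z (hz ▸ h1)).le
      _ = (majorant N a (φ 0)).re := circleAverage_re_of_differentiableOn hg h0.le h1
      _ ≤ _ := by
          refine (re_majorant_le N a hφ0).trans ?_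
          have : 0 ≤ (1 + ‖φ 0‖) / (1 - ‖φ 0‖) := div_nonneg (by positivity) (by linarith)
          exact mul_le_mul_of_nonneg_left (h2.sum_le_tsum _ fun _ _ => sq_nonneg _) this
  -- The maximum of `‖φ‖` on the circle is below `1`, so the series converges absolutely there and
  -- supplies a constant dominating function.
  obtain ⟨z₀, hz₀, hmax⟩ := (isCompact_sphere (0 : ℂ) r).exists_isMaxOn
    (NormedSpace.sphere_nonempty.2 h0.le) (f := fun z => ‖φ z‖)
    (hφ.continuousOn.norm.mono fun z hz => by
      rw [mem_sphere_zero_iff_norm] at hz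
      simpa [hz] using h1)
  have hρ : ‖φ z₀‖ < 1 := hφ1 z₀ (by rw [mem_sphere_zero_iff_norm.1 hz₀]; exact h1)
  have hsum := summable_norm_of_hasSum ha (norm_nonneg (φ z₀)) hρ
  have hmem : ∀ θ, circleMap 0 r θ ∈ sphere (0 : ℂ) r := circleMap_mem_sphere 0 h0.le
  have hmemb : ∀ θ, ‖circleMap 0 r θ‖ < 1 := fun θ => by
    rw [mem_sphere_zero_iff_norm.1 (hmem θ)]; exact h1
  refine le_of_tendsto' (x := atTop) (Tendsto.const_smul ?_ _) bound
  refine intervalIntegral.tendsto_integral_filter_of_dominated_convergence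
    (fun _ => (∑' n, ‖a n‖ * ‖φ z₀‖ ^ n) ^ 2) (Eventually.of_forall fun N => ?_)
    (Eventually.of_forall fun N => MeasureTheory.ae_of_all _ fun θ _ => ?_) intervalIntegrable_const
    (MeasureTheory.ae_of_all _ fun θ _ => ?_)
  · refine Continuous.aestronglyMeasurable (Continuous.pow (Continuous.norm ?_) 2)
    refine ((differentiable_horner N a).continuous.comp_continuousOn hφ.continuousOn).comp_continuous
      (continuous_circleMap 0 r) fun θ => by simpa using hmemb θ
  · rw [norm_pow, norm_norm, horner_eq_sum]
    refine pow_le_pow_left₀ (norm_nonneg _) ((norm_sum_le _ _).trans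
      (le_trans (Finset.sum_le_sum fun n _ => ?_) (hsum.sum_le_tsum (Finset.range N) fun n _ => ?_))) 2
    · rw [norm_mul, norm_pow]
      exact mul_le_mul_of_nonneg_left (pow_le_pow_left₀ (norm_nonneg _) (hmax (hmem θ)) n)
        (norm_nonneg _)
    · positivity
  · simp only [horner_eq_sum]
    exact ((ha _ (hφ1 _ (hmemb θ))).tendsto_sum_nat.norm).pow 2

/-- Littlewood's subordination theorem, with the bound for an arbitrary value at the centre. -/
theorem littlewood_subordination {a b : ℕ → ℂ} {f φ : ℂ → ℂ}
    (ha : ∀ z : ℂ, ‖z‖ < 1 → HasSum (fun n => a n * z ^ n) (f z)) (h2 : Summable fun n => ‖a n‖ ^ 2)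
    (hφ : DifferentiableOn ℂ φ (ball 0 1)) (hφ1 : ∀ z : ℂ, ‖z‖ < 1 → ‖φ z‖ < 1)
    (hb : ∀ z : ℂ, ‖z‖ < 1 → HasSum (fun n => b n * z ^ n) (f (φ z))) :
    Summable (fun n => ‖b n‖ ^ 2) ∧
      ∑' n, ‖b n‖ ^ 2 ≤ (1 + ‖φ 0‖) / (1 - ‖φ 0‖) * ∑' n, ‖a n‖ ^ 2 := by
  have bound : ∀ K, ∑ n ∈ Finset.range K, ‖b n‖ ^ 2 ≤
      (1 + ‖φ 0‖) / (1 - ‖φ 0‖) * ∑' n, ‖a n‖ ^ 2 := by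
    intro K
    -- For finitely many coefficients, `r → 1` is mere continuity.
    have hc : Tendsto (fun r : ℝ => ∑ n ∈ Finset.range K, ‖b n‖ ^ 2 * (r ^ 2) ^ n) (𝓝[<] 1)
        (𝓝 (∑ n ∈ Finset.range K, ‖b n‖ ^ 2)) := by
      have : Continuous fun r : ℝ => ∑ n ∈ Finset.range K, ‖b n‖ ^ 2 * (r ^ 2) ^ n := by fun_prop
      simpa using (this.tendsto 1).mono_left nhdsWithin_le_nhds
    refine le_of_tendsto hc ?_
    filter_upwards [Ioo_mem_nhdsLT (zero_lt_one (α := ℝ))] with r hr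
    exact (sum_norm_coeff_sq_le_circleAverage K hb hr.1 hr.2).trans
      (circleAverage_norm_comp_sq_le ha h2 hφ hφ1 hr.1 hr.2)
  exact ⟨summable_of_sum_range_le (fun _ => sq_nonneg _) bound,
    Real.tsum_le_of_sum_range_le (fun _ => sq_nonneg _) bound⟩

theorem exists_hasSum_of_differentiableOn {F : ℂ → ℂ} (hF : DifferentiableOn ℂ F (ball 0 1)) :
    ∃ b : ℕ → ℂ, ∀ z : ℂ, ‖z‖ < 1 → HasSum (fun n => b n * z ^ n) (F z) := by
  refine ⟨fun n => (n.factorial : ℂ)⁻¹ * iteratedDeriv n F 0, fun z hz => ?_⟩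
  have := Complex.hasSum_taylorSeries_on_ball hF (z := z) (by simpa using hz)
  refine this.congr_fun fun n => ?_
  simp only [sub_zero, smul_eq_mul]
  ring

/-! ## Functions of two variables with a derivative off the cross -/

/-- Boundedness of the quotient at `(z, w)` gives `‖G p - G z w‖ ≤ C ‖p.1 - z‖` on a product of
punctured neighbourhoods. Letting `p` tend to `(z, w')` off the cross forces the limit `G z w`,
while the hypothesis at `w'` forces `G z w'`. -/
theorem eventually_eq_of_offCross_tendsto {G : ℂ → ℂ → ℂ} {z w : ℂ} {U : Set ℂ} (hU : U ∈ 𝓝 w)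
    (hG : ∀ w' ∈ U, ∃ c, Tendsto (fun p : ℂ × ℂ => (G p.1 p.2 - G z w') * (p.1 - z)⁻¹)
      (𝓝[≠] z ×ˢ 𝓝[≠] w') (𝓝 c)) :
    ∀ᶠ w' in 𝓝 w, G z w' = G z w := by
  have hdiff : ∀ w' : ℂ, Tendsto (fun p : ℂ × ℂ => p.1 - z) (𝓝[≠] z ×ˢ 𝓝[≠] w') (𝓝 0) := by
    intro w'
    have h : Tendsto (fun p : ℂ => p - z) (𝓝[≠] z) (𝓝 (z - z)) :=
      ((continuous_id.sub continuous_const).tendsto z).mono_left nhdsWithin_le_nhds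
    rw [sub_self] at h
    exact h.comp tendsto_fst
  have hne : ∀ w' : ℂ, ∀ᶠ p : ℂ × ℂ in 𝓝[≠] z ×ˢ 𝓝[≠] w', p.1 ≠ z := fun w' =>
    tendsto_fst.eventually (self_mem_nhdsWithin : {z}ᶜ ∈ 𝓝[≠] z)
  have hcont : ∀ w' ∈ U, Tendsto (fun p : ℂ × ℂ => G p.1 p.2) (𝓝[≠] z ×ˢ 𝓝[≠] w')
      (𝓝 (G z w')) := by
    intro w' hw'
    obtain ⟨c, hc⟩ := hG w' hw'
    have h := (hc.mul (hdiff w')).add_const (G z w')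
    rw [mul_zero, zero_add] at h
    refine h.congr' ((hne w').mono fun p hp => ?_)
    rw [inv_mul_cancel_right₀ (sub_ne_zero.2 hp), sub_add_cancel]
  obtain ⟨c, hc⟩ := hG w (mem_of_mem_nhds hU)
  have hbound : ∀ᶠ p : ℂ × ℂ in 𝓝[≠] z ×ˢ 𝓝[≠] w,
      ‖G p.1 p.2 - G z w‖ ≤ (‖c‖ + 1) * ‖p.1 - z‖ := by
    filter_upwards [hc.norm.eventually_lt_const (lt_add_one ‖c‖), hne w] with p hp hpz
    have hpos : 0 < ‖p.1 - z‖ := norm_pos_iff.2 (sub_ne_zero.2 hpz)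
    rw [norm_mul, norm_inv, ← div_eq_mul_inv, div_lt_iff₀ hpos] at hp
    exact hp.le
  obtain ⟨A, hA, V, hV, hAV⟩ := mem_prod_iff.1 hbound
  -- The same estimate must be usable near `w'`: away from `w`, a punctured neighbourhood of `w` is
  -- a neighbourhood of its nearby points.
  have hV' : ∀ᶠ w' in 𝓝[≠] w, V ∈ 𝓝[≠] w' := by
    filter_upwards [eventually_eventually_nhdsWithin.2 hV, self_mem_nhdsWithin] with w' h hw'
    have h : V ∈ 𝓝[{w}ᶜ] w' := h
    rw [isOpen_compl_singleton.nhdsWithin_eq hw'] at h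
    exact mem_nhdsWithin_of_mem_nhds h
  have hpunct : ∀ᶠ w' in 𝓝[≠] w, G z w' = G z w := by
    filter_upwards [hV', mem_nhdsWithin_of_mem_nhds hU] with w' hw' hw'U
    refine tendsto_nhds_unique (hcont w' hw'U) ?_
    rw [tendsto_iff_norm_sub_tendsto_zero]
    refine squeeze_zero' (Eventually.of_forall fun _ => norm_nonneg _)
      (mem_of_superset (prod_mem_prod hA hw') hAV) ?_
    simpa using (hdiff w').norm.const_mul (‖c‖ + 1)
  rw [eventually_nhdsWithin_iff] at hpunct
  filter_upwards [hpunct] with w' h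
  rcases eq_or_ne w' w with rfl | hne
  · rfl
  · exact h hne

/-- Local constancy in the second variable becomes constancy because the disc is connected. The
quotient then depends on the first variable only, and its limit descends along `Prod.fst` to an
ordinary derivative. -/
theorem exists_differentiableOn_of_offCross_tendsto {G : ℂ → ℂ → ℂ}
    (hG : ∀ z ∈ ball (0 : ℂ) 1, ∀ w ∈ ball (0 : ℂ) 1, ∃ c,
      Tendsto (fun p : ℂ × ℂ => (G p.1 p.2 - G z w) * (p.1 - z)⁻¹)
        (𝓝[≠] z ×ˢ 𝓝[≠] w) (𝓝 c)) :
    ∃ g : ℂ → ℂ, DifferentiableOn ℂ g (ball 0 1) ∧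
      ∀ z ∈ ball (0 : ℂ) 1, ∀ w ∈ ball (0 : ℂ) 1, G z w = g z := by
  have h0 : (0 : ℂ) ∈ ball (0 : ℂ) 1 := mem_ball_self one_pos
  have hconst : ∀ z ∈ ball (0 : ℂ) 1, ∀ w ∈ ball (0 : ℂ) 1, G z w = G z 0 := by
    intro z hz w hw
    have hd : ∀ w ∈ ball (0 : ℂ) 1, HasDerivAt (G z) 0 w := fun w hw =>
      (hasDerivAt_const w (G z w)).congr_of_eventuallyEq
        (eventually_eq_of_offCross_tendsto (isOpen_ball.mem_nhds hw) (hG z hz))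
    exact isOpen_ball.is_const_of_deriv_eq_zero (convex_ball (0 : ℂ) 1).isPreconnected
      (fun w hw => (hd w hw).differentiableAt.differentiableWithinAt)
      (fun w hw => (hd w hw).deriv) hw h0
  refine ⟨fun z => G z 0, fun z hz => ?_, hconst⟩
  obtain ⟨c, hc⟩ := hG z hz 0 h0
  have hD : ∀ w ∈ ball (0 : ℂ) 1, ∀ᶠ x in 𝓝[≠] w, x ∈ ball (0 : ℂ) 1 := fun w hw =>
    mem_nhdsWithin_of_mem_nhds (isOpen_ball.mem_nhds hw)
  have h : Tendsto ((fun x => (G x 0 - G z 0) * (x - z)⁻¹) ∘ Prod.fst)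
      (𝓝[≠] z ×ˢ 𝓝[≠] (0 : ℂ)) (𝓝 c) := by
    refine hc.congr' ?_
    filter_upwards [(hD z hz).prod_mk (hD 0 h0)] with p hp
    simp only [Function.comp, hconst p.1 hp.1 p.2 hp.2]
  rw [← tendsto_map'_iff, map_fst_prod] at h
  have hder : HasDerivAt (fun z => G z 0) c z := by
    rw [hasDerivAt_iff_tendsto_slope]
    refine h.congr fun x => ?_
    rw [slope_def_field, div_eq_mul_inv]
  exact hder.differentiableAt.differentiableWithinAt

/-! ## Idempotent components of bicomplex and hyperbolic numbers -/

/-- The bicomplex number `e₁ z + e₂ w`. -/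
def ofComp (z w : ℂ) : BC := ⟨(z + w) / 2, Complex.I * (z - w) / 2⟩

@[simp] theorem comp₁_ofComp (z w : ℂ) : comp₁ (ofComp z w) = z := by
  simp only [comp₁, ofComp, RingHom.coe_mk, MonoidHom.coe_mk, OneHom.coe_mk]
  linear_combination (-(z - w) / 2) * Complex.I_sq

@[simp] theorem comp₂_ofComp (z w : ℂ) : comp₂ (ofComp z w) = w := by
  simp only [comp₂, ofComp, RingHom.coe_mk, MonoidHom.coe_mk, OneHom.coe_mk]
  linear_combination ((z - w) / 2) * Complex.I_sq

theorem ext_comp {Z W : BC} (h₁ : comp₁ Z = comp₁ W) (h₂ : comp₂ Z = comp₂ W) : Z = W := by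
  rw [idempotent_representation Z, idempotent_representation W, h₁, h₂]

@[simp] theorem ofComp_comp (Z : BC) : ofComp (comp₁ Z) (comp₂ Z) = Z :=
  ext_comp (comp₁_ofComp _ _) (comp₂_ofComp _ _)

theorem continuous_ofComp : Continuous fun p : ℂ × ℂ => ofComp p.1 p.2 := by
  refine continuous_induced_rng.2 ?_
  change Continuous fun p : ℂ × ℂ => ((p.1 + p.2) / 2, Complex.I * (p.1 - p.2) / 2)
  fun_prop

theorem tendsto_iff_comp {α : Type*} {u : α → BC} {l : Filter α} {Z : BC} :
    Tendsto u l (𝓝 Z) ↔ Tendsto (fun x => comp₁ (u x)) l (𝓝 (comp₁ Z)) ∧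
      Tendsto (fun x => comp₂ (u x)) l (𝓝 (comp₂ Z)) := by
  refine ⟨fun h => ⟨(continuous_comp₁.tendsto Z).comp h, (continuous_comp₂.tendsto Z).comp h⟩,
    fun h => ?_⟩
  have := (continuous_ofComp.tendsto (comp₁ Z, comp₂ Z)).comp (h.1.prodMk_nhds h.2)
  simpa [Function.comp_def] using this

theorem hasSum_iff_comp {ι : Type*} {u : ι → BC} {Z : BC} :
    HasSum u Z ↔ HasSum (fun i => comp₁ (u i)) (comp₁ Z) ∧
      HasSum (fun i => comp₂ (u i)) (comp₂ Z) := by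
  simp only [HasSum, ← map_sum]
  exact tendsto_iff_comp

theorem isUnit_iff_comp {Z : BC} : IsUnit Z ↔ comp₁ Z ≠ 0 ∧ comp₂ Z ≠ 0 := by
  refine ⟨fun h => ⟨(h.map comp₁).ne_zero, (h.map comp₂).ne_zero⟩, fun h => ?_⟩
  refine IsUnit.of_mul_eq_one (ofComp (comp₁ Z)⁻¹ (comp₂ Z)⁻¹) (ext_comp ?_ ?_)
  · rw [map_mul, comp₁_ofComp, mul_inv_cancel₀ h.1, map_one]
  · rw [map_mul, comp₂_ofComp, mul_inv_cancel₀ h.2, map_one]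

theorem comp₁_inverse {Z : BC} (h : IsUnit Z) : comp₁ Z⁻¹ʳ = (comp₁ Z)⁻¹ := by
  refine eq_inv_of_mul_eq_one_right ?_
  rw [← map_mul, Ring.mul_inverse_cancel Z h, map_one]

theorem comp₂_inverse {Z : BC} (h : IsUnit Z) : comp₂ Z⁻¹ʳ = (comp₂ Z)⁻¹ := by
  refine eq_inv_of_mul_eq_one_right ?_
  rw [← map_mul, Ring.mul_inverse_cancel Z h, map_one]

namespace Hyp

theorem fst_mul (α β : Hyp) : (α * β).fst = α.fst * β.fst := by
  simp only [fst, QuadraticAlgebra.re_mul, QuadraticAlgebra.im_mul]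
  ring

theorem snd_mul (α β : Hyp) : (α * β).snd = α.snd * β.snd := by
  simp only [snd, QuadraticAlgebra.re_mul, QuadraticAlgebra.im_mul]
  ring

/-- The first idempotent component, as a ring homomorphism. -/
def fstHom : Hyp →+* ℝ where
  toFun := fst
  map_one' := by simp [fst, QuadraticAlgebra.re_one, QuadraticAlgebra.im_one]
  map_zero' := by simp [fst]
  map_add' α β := by simp [fst]; ring
  map_mul' := fst_mul

/-- The second idempotent component, as a ring homomorphism. -/
def sndHom : Hyp →+* ℝ where
  toFun := snd
  map_one' := by simp [snd, QuadraticAlgebra.re_one, QuadraticAlgebra.im_one]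
  map_zero' := by simp [snd]
  map_add' α β := by simp [snd]; ring
  map_mul' := snd_mul

theorem fstHom_apply (α : Hyp) : fstHom α = α.fst := rfl

theorem sndHom_apply (α : Hyp) : sndHom α = α.snd := rfl

theorem le_iff {α β : Hyp} : α ≤ β ↔ α.fst ≤ β.fst ∧ α.snd ≤ β.snd := by
  change 0 ≤ fstHom (β - α) ∧ 0 ≤ sndHom (β - α) ↔ _
  rw [map_sub, map_sub, sub_nonneg, sub_nonneg]
  rfl

theorem fst_sqrt (α : Hyp) : (sqrt α).fst = Real.sqrt α.fst := fst_ofIdem _ _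

theorem snd_sqrt (α : Hyp) : (sqrt α).snd = Real.sqrt α.snd := snd_ofIdem _ _

theorem isUnit_of_ne_zero {α : Hyp} (h₁ : α.fst ≠ 0) (h₂ : α.snd ≠ 0) : IsUnit α := by
  refine IsUnit.of_mul_eq_one (ofIdem α.fst⁻¹ α.snd⁻¹) (ext_idem ?_ ?_)
  · rw [fst_mul, fst_ofIdem, mul_inv_cancel₀ h₁]
    exact (map_one fstHom).symm
  · rw [snd_mul, snd_ofIdem, mul_inv_cancel₀ h₂]
    exact (map_one sndHom).symm

theorem fst_inverse {α : Hyp} (h : IsUnit α) : α⁻¹ʳ.fst = α.fst⁻¹ := by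
  refine eq_inv_of_mul_eq_one_right ?_
  rw [← fst_mul, Ring.mul_inverse_cancel α h]
  exact map_one fstHom

theorem snd_inverse {α : Hyp} (h : IsUnit α) : α⁻¹ʳ.snd = α.snd⁻¹ := by
  refine eq_inv_of_mul_eq_one_right ?_
  rw [← snd_mul, Ring.mul_inverse_cancel α h]
  exact map_one sndHom

theorem continuous_equivProd : Continuous (QuadraticAlgebra.equivProd (1 : ℝ) 0) :=
  continuous_induced_dom

theorem continuous_fst : Continuous fst :=
  continuous_equivProd.fst.add continuous_equivProd.snd

theorem continuous_snd : Continuous snd :=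
  continuous_equivProd.fst.sub continuous_equivProd.snd

theorem continuous_ofIdem : Continuous fun p : ℝ × ℝ => ofIdem p.1 p.2 := by
  refine continuous_induced_rng.2 ?_
  change Continuous fun p : ℝ × ℝ => ((p.1 + p.2) / 2, (p.1 - p.2) / 2)
  fun_prop

/-- Uniqueness of limits lets `tsum` be evaluated from `HasSum`. -/
instance : T2Space Hyp :=
  T2Space.of_injective_continuous (QuadraticAlgebra.equivProd (1 : ℝ) 0).injective
    continuous_equivProd

theorem ofIdem_fst_snd (α : Hyp) : ofIdem α.fst α.snd = α :=
  ext_idem (fst_ofIdem _ _) (snd_ofIdem _ _)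

theorem tendsto_iff {ι : Type*} {u : ι → Hyp} {l : Filter ι} {α : Hyp} :
    Tendsto u l (𝓝 α) ↔ Tendsto (fun x => (u x).fst) l (𝓝 α.fst) ∧
      Tendsto (fun x => (u x).snd) l (𝓝 α.snd) := by
  refine ⟨fun h => ⟨(continuous_fst.tendsto α).comp h, (continuous_snd.tendsto α).comp h⟩,
    fun h => ?_⟩
  have := (continuous_ofIdem.tendsto (α.fst, α.snd)).comp (h.1.prodMk_nhds h.2)
  simpa only [Function.comp_def, ofIdem_fst_snd] using this

theorem hasSum_iff {ι : Type*} {u : ι → Hyp} {α : Hyp} :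
    HasSum u α ↔ HasSum (fun i => (u i).fst) α.fst ∧ HasSum (fun i => (u i).snd) α.snd := by
  simp only [HasSum, ← fstHom_apply, ← sndHom_apply, ← map_sum]
  exact tendsto_iff

/-- The order is the product order in the idempotent components, so suprema are taken componentwise.
-/
theorem isLUB_ofIdem {S : Set Hyp} (hS : S.Nonempty) (hb : BddAbove S) :
    IsLUB S (ofIdem (sSup (fst '' S)) (sSup (snd '' S))) := by
  obtain ⟨B, hB⟩ := hb
  have h₁ : IsLUB (fst '' S) (sSup (fst '' S)) :=
    isLUB_csSup (hS.image _) ⟨B.fst, by rintro _ ⟨α, hα, rfl⟩; exact (le_iff.1 (hB hα)).1⟩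
  have h₂ : IsLUB (snd '' S) (sSup (snd '' S)) :=
    isLUB_csSup (hS.image _) ⟨B.snd, by rintro _ ⟨α, hα, rfl⟩; exact (le_iff.1 (hB hα)).2⟩
  refine ⟨fun α hα => le_iff.2 ?_, fun β hβ => le_iff.2 ?_⟩
  · rw [fst_ofIdem, snd_ofIdem]
    exact ⟨h₁.1 ⟨α, hα, rfl⟩, h₂.1 ⟨α, hα, rfl⟩⟩
  · rw [fst_ofIdem, snd_ofIdem]
    exact ⟨h₁.2 (by rintro _ ⟨α, hα, rfl⟩; exact (le_iff.1 (hβ hα)).1),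
      h₂.2 (by rintro _ ⟨α, hα, rfl⟩; exact (le_iff.1 (hβ hα)).2)⟩

end Hyp

/-! ## Componentwise description of bicomplex holomorphic functions -/

theorem mem_unitDisc {Z : BC} : Z ∈ unitDisc ↔ ‖comp₁ Z‖ < 1 ∧ ‖comp₂ Z‖ < 1 := Iff.rfl

/-- The point `e₁ z + e₂ w` of the unit disc (the centre, if it lies outside the disc). -/
def discPoint (z w : ℂ) : unitDisc :=
  open Classical in if h : ofComp z w ∈ unitDisc then ⟨ofComp z w, h⟩ else 0

theorem coe_discPoint {z w : ℂ} (hz : ‖z‖ < 1) (hw : ‖w‖ < 1) :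
    (discPoint z w : BC) = ofComp z w := by
  rw [discPoint, dif_pos (by simpa [mem_unitDisc] using ⟨hz, hw⟩)]

theorem discPoint_comp (Z : unitDisc) : discPoint (comp₁ Z) (comp₂ Z) = Z := by
  refine Subtype.ext ?_
  rw [coe_discPoint Z.2.1 Z.2.2, ofComp_comp]

theorem coe_zero_unitDisc : ((0 : unitDisc) : BC) = 0 := rfl

/-- `f` acts on the idempotent components separately, by `f₁` and `f₂`. -/
def HasComps (f : unitDisc → BC) (f₁ f₂ : ℂ → ℂ) : Prop :=
  ∀ Z : unitDisc, comp₁ (f Z) = f₁ (comp₁ Z) ∧ comp₂ (f Z) = f₂ (comp₂ Z)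

theorem tendsto_discPoint {z w : ℂ} (hz : ‖z‖ < 1) (hw : ‖w‖ < 1) :
    Tendsto (fun p : ℂ × ℂ => discPoint p.1 p.2) (𝓝[≠] z ×ˢ 𝓝[≠] w)
      (𝓝[{W : unitDisc | IsUnit ((W : BC) - (discPoint z w : BC))}] (discPoint z w)) := by
  have hD : ∀ x : ℂ, ‖x‖ < 1 → ∀ᶠ y in 𝓝[≠] x, ‖y‖ < 1 := fun x hx =>
    mem_nhdsWithin_of_mem_nhds ((isOpen_lt continuous_norm continuous_const).mem_nhds hx)
  have hev := (hD z hz).prod_mk (hD w hw)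
  have hne : ∀ x : ℂ, ∀ᶠ y in 𝓝[≠] x, y ≠ x := fun x => self_mem_nhdsWithin
  refine tendsto_nhdsWithin_iff.2 ⟨tendsto_subtype_rng.2 ?_, ?_⟩
  · rw [coe_discPoint hz hw]
    refine Tendsto.congr' (hev.mono fun p hp => (coe_discPoint hp.1 hp.2).symm) ?_
    refine (continuous_ofComp.tendsto (z, w)).mono_left ?_
    rw [nhds_prod_eq]
    exact prod_mono nhdsWithin_le_nhds nhdsWithin_le_nhds
  · filter_upwards [hev, (hne z).prod_mk (hne w)] with p hp hpne
    simp only [isUnit_iff_comp, map_sub, coe_discPoint hz hw,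
      coe_discPoint hp.1 hp.2, comp₁_ofComp, comp₂_ofComp]
    exact ⟨sub_ne_zero.2 hpne.1, sub_ne_zero.2 hpne.2⟩

/-- Invertible increments are those with both components nonzero, which is approach through the
product of punctured neighbourhoods; inverses are componentwise. -/
theorem IsBCHolomorphic.exists_tendsto_comp {f : unitDisc → BC} (hf : IsBCHolomorphic f) {z w : ℂ}
    (hz : ‖z‖ < 1) (hw : ‖w‖ < 1) : ∃ c : BC,
      Tendsto (fun p : ℂ × ℂ => (comp₁ (f (discPoint p.1 p.2)) - comp₁ (f (discPoint z w))) *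
        (p.1 - z)⁻¹) (𝓝[≠] z ×ˢ 𝓝[≠] w) (𝓝 (comp₁ c)) ∧
      Tendsto (fun p : ℂ × ℂ => (comp₂ (f (discPoint p.1 p.2)) - comp₂ (f (discPoint z w))) *
        (p.2 - w)⁻¹) (𝓝[≠] z ×ˢ 𝓝[≠] w) (𝓝 (comp₂ c)) := by
  have hD : ∀ x : ℂ, ‖x‖ < 1 → ∀ᶠ y in 𝓝[≠] x, ‖y‖ < 1 := fun x hx =>
    mem_nhdsWithin_of_mem_nhds ((isOpen_lt continuous_norm continuous_const).mem_nhds hx)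
  obtain ⟨c, hc⟩ := hf (discPoint z w)
  have ht := tendsto_discPoint hz hw
  have h := tendsto_iff_comp.1 (hc.comp ht)
  have hunit := (tendsto_nhdsWithin_iff.1 ht).2
  have hev := (hD z hz).prod_mk (hD w hw)
  refine ⟨c, h.1.congr' ?_, h.2.congr' ?_⟩
  · filter_upwards [hunit, hev] with p hu hp
    have hu : IsUnit ((discPoint p.1 p.2 : BC) - (discPoint z w : BC)) := hu
    rw [Function.comp_apply, map_mul, comp₁_inverse hu, map_sub, map_sub, coe_discPoint hz hw,
      coe_discPoint hp.1 hp.2, comp₁_ofComp, comp₁_ofComp]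
  · filter_upwards [hunit, hev] with p hu hp
    have hu : IsUnit ((discPoint p.1 p.2 : BC) - (discPoint z w : BC)) := hu
    rw [Function.comp_apply, map_mul, comp₂_inverse hu, map_sub, map_sub, coe_discPoint hz hw,
      coe_discPoint hp.1 hp.2, comp₂_ofComp, comp₂_ofComp]

theorem IsBCHolomorphic.exists_hasComps {f : unitDisc → BC} (hf : IsBCHolomorphic f) :
    ∃ f₁ f₂ : ℂ → ℂ, DifferentiableOn ℂ f₁ (ball 0 1) ∧ DifferentiableOn ℂ f₂ (ball 0 1) ∧
      HasComps f f₁ f₂ := by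
  have k₁ : ∀ z ∈ ball (0 : ℂ) 1, ∀ w ∈ ball (0 : ℂ) 1, ∃ c : ℂ, Tendsto (fun p : ℂ × ℂ =>
      (comp₁ (f (discPoint p.1 p.2)) - comp₁ (f (discPoint z w))) * (p.1 - z)⁻¹)
      (𝓝[≠] z ×ˢ 𝓝[≠] w) (𝓝 c) := fun z hz w hw => by
    rw [mem_ball_zero_iff] at hz hw
    obtain ⟨c, hc, -⟩ := hf.exists_tendsto_comp hz hw
    exact ⟨comp₁ c, hc⟩
  -- The variables are swapped so that the two-variable lemma, which divides by the first increment,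
  -- covers the second component.
  have k₂ : ∀ w ∈ ball (0 : ℂ) 1, ∀ z ∈ ball (0 : ℂ) 1, ∃ c : ℂ, Tendsto (fun p : ℂ × ℂ =>
      (comp₂ (f (discPoint p.2 p.1)) - comp₂ (f (discPoint z w))) * (p.1 - w)⁻¹)
      (𝓝[≠] w ×ˢ 𝓝[≠] z) (𝓝 c) := fun w hw z hz => by
    rw [mem_ball_zero_iff] at hz hw
    obtain ⟨c, -, hc⟩ := hf.exists_tendsto_comp hz hw
    have := hc.comp (tendsto_prod_swap (f := 𝓝[≠] w) (g := 𝓝[≠] z))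
    refine ⟨comp₂ c, this.congr fun p => ?_⟩
    rw [Function.comp_apply, Prod.fst_swap, Prod.snd_swap]
  obtain ⟨f₁, hd₁, h₁⟩ := exists_differentiableOn_of_offCross_tendsto
    (G := fun z w => comp₁ (f (discPoint z w))) k₁
  obtain ⟨f₂, hd₂, h₂⟩ := exists_differentiableOn_of_offCross_tendsto
    (G := fun w z => comp₂ (f (discPoint z w))) k₂
  refine ⟨f₁, f₂, hd₁, hd₂, fun Z => ?_⟩
  have hZ₁ : comp₁ (Z : BC) ∈ ball (0 : ℂ) 1 := mem_ball_zero_iff.2 Z.2.1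
  have hZ₂ : comp₂ (Z : BC) ∈ ball (0 : ℂ) 1 := mem_ball_zero_iff.2 Z.2.2
  have E₁ : comp₁ (f (discPoint (comp₁ Z) (comp₂ Z))) = f₁ (comp₁ Z) := h₁ _ hZ₁ _ hZ₂
  have E₂ : comp₂ (f (discPoint (comp₁ Z) (comp₂ Z))) = f₂ (comp₂ Z) := h₂ _ hZ₂ _ hZ₁
  rw [discPoint_comp] at E₁ E₂
  exact ⟨E₁, E₂⟩

theorem HasComps.isBCHolomorphic {f : unitDisc → BC} {f₁ f₂ : ℂ → ℂ} (hf : HasComps f f₁ f₂)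
    (h₁ : DifferentiableOn ℂ f₁ (ball 0 1)) (h₂ : DifferentiableOn ℂ f₂ (ball 0 1)) :
    IsBCHolomorphic f := by
  intro Z
  have slope_tendsto : ∀ {g : ℂ → ℂ} {z : ℂ}, DifferentiableOn ℂ g (ball 0 1) → ‖z‖ < 1 →
      Tendsto (fun x => (g x - g z) * (x - z)⁻¹) (𝓝[≠] z) (𝓝 (deriv g z)) := by
    intro g z hg hz
    have := (hg.differentiableAt (isOpen_ball.mem_nhds (by simpa using hz))).hasDerivAt
    rw [hasDerivAt_iff_tendsto_slope] at this
    refine this.congr fun x => ?_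
    rw [slope_def_field, div_eq_mul_inv]
  have hu : ∀ᶠ W : unitDisc in 𝓝[{W : unitDisc | IsUnit ((W : BC) - (Z : BC))}] Z,
      IsUnit ((W : BC) - (Z : BC)) := self_mem_nhdsWithin
  have t₁ : Tendsto (fun W : unitDisc => comp₁ (W : BC))
      (𝓝[{W : unitDisc | IsUnit ((W : BC) - (Z : BC))}] Z) (𝓝[≠] (comp₁ (Z : BC))) := by
    refine tendsto_nhdsWithin_iff.2 ⟨((continuous_comp₁.comp continuous_subtype_val).tendsto
      Z).mono_left nhdsWithin_le_nhds, hu.mono fun W hW => ?_⟩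
    have := (isUnit_iff_comp.1 hW).1
    rw [map_sub] at this
    exact sub_ne_zero.1 this
  have t₂ : Tendsto (fun W : unitDisc => comp₂ (W : BC))
      (𝓝[{W : unitDisc | IsUnit ((W : BC) - (Z : BC))}] Z) (𝓝[≠] (comp₂ (Z : BC))) := by
    refine tendsto_nhdsWithin_iff.2 ⟨((continuous_comp₂.comp continuous_subtype_val).tendsto
      Z).mono_left nhdsWithin_le_nhds, hu.mono fun W hW => ?_⟩
    have := (isUnit_iff_comp.1 hW).2
    rw [map_sub] at this
    exact sub_ne_zero.1 this
  refine ⟨ofComp (deriv f₁ (comp₁ Z)) (deriv f₂ (comp₂ Z)), tendsto_iff_comp.2 ⟨?_, ?_⟩⟩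
  · rw [comp₁_ofComp]
    refine ((slope_tendsto h₁ Z.2.1).comp t₁).congr' (hu.mono fun W hW => ?_)
    simp only [Function.comp, map_mul, map_sub, comp₁_inverse hW, (hf _).1]
  · rw [comp₂_ofComp]
    refine ((slope_tendsto h₂ Z.2.2).comp t₂).congr' (hu.mono fun W hW => ?_)
    simp only [Function.comp, map_mul, map_sub, comp₂_inverse hW, (hf _).2]

/-! ## Componentwise description of the bicomplex Hardy space -/

/-- Each scalar series is read off at points whose other component is `0`. -/
theorem HasComps.hasCoeffs_iff {f : unitDisc → BC} {f₁ f₂ : ℂ → ℂ} (hf : HasComps f f₁ f₂)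
    {a : ℕ → BC} : HasCoeffs f a ↔
      (∀ z : ℂ, ‖z‖ < 1 → HasSum (fun n => comp₁ (a n) * z ^ n) (f₁ z)) ∧
      (∀ z : ℂ, ‖z‖ < 1 → HasSum (fun n => comp₂ (a n) * z ^ n) (f₂ z)) := by
  have h0 : ‖(0 : ℂ)‖ < 1 := by simp
  constructor
  · intro h
    refine ⟨fun z hz => ?_, fun z hz => ?_⟩
    · have := (hasSum_iff_comp.1 (h (discPoint z 0))).1
      simpa [(hf _).1, coe_discPoint hz h0] using this
    · have := (hasSum_iff_comp.1 (h (discPoint 0 z))).2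
      simpa [(hf _).2, coe_discPoint h0 hz] using this
  · rintro ⟨h₁, h₂⟩ Z
    refine hasSum_iff_comp.2 ⟨?_, ?_⟩
    · simpa [(hf _).1] using h₁ _ Z.2.1
    · simpa [(hf _).2] using h₂ _ Z.2.2

theorem HasCoeffs.coeff_eq {f : unitDisc → BC} {a : ℕ → BC} (h : HasCoeffs f a) : coeff f = a := by
  have hex : ∃ a, HasCoeffs f a := ⟨a, h⟩
  rw [coeff, dif_pos hex]
  exact hex.choose_spec.unique h

theorem fst_hypMod (Z : BC) : (hypMod Z).fst = ‖comp₁ Z‖ := Hyp.fst_ofIdem _ _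

theorem snd_hypMod (Z : BC) : (hypMod Z).snd = ‖comp₂ Z‖ := Hyp.snd_ofIdem _ _

theorem fst_hypMod_sq (Z : BC) : (hypMod Z ^ 2).fst = ‖comp₁ Z‖ ^ 2 := by
  rw [← fst_hypMod, ← Hyp.fstHom_apply, map_pow, Hyp.fstHom_apply]

theorem snd_hypMod_sq (Z : BC) : (hypMod Z ^ 2).snd = ‖comp₂ Z‖ ^ 2 := by
  rw [← snd_hypMod, ← Hyp.sndHom_apply, map_pow, Hyp.sndHom_apply]

theorem exists_components_of_mem_H2 {f : unitDisc → BC} (hf : f ∈ H2) :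
    ∃ (f₁ f₂ : ℂ → ℂ) (a₁ a₂ : ℕ → ℂ), HasComps f f₁ f₂ ∧
      (∀ z : ℂ, ‖z‖ < 1 → HasSum (fun n => a₁ n * z ^ n) (f₁ z)) ∧
      (∀ z : ℂ, ‖z‖ < 1 → HasSum (fun n => a₂ n * z ^ n) (f₂ z)) ∧
      Summable (fun n => ‖a₁ n‖ ^ 2) ∧ Summable (fun n => ‖a₂ n‖ ^ 2) := by
  obtain ⟨hol, hc, hs⟩ := hf
  obtain ⟨f₁, f₂, -, -, hcomp⟩ := hol.exists_hasComps
  have h := hcomp.hasCoeffs_iff.1 hc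
  have hs := Hyp.hasSum_iff.1 hs.hasSum
  simp only [fst_hypMod_sq, snd_hypMod_sq] at hs
  exact ⟨f₁, f₂, _, _, hcomp, h.1, h.2, hs.1.summable, hs.2.summable⟩

theorem HasComps.mem_H2 {f : unitDisc → BC} {f₁ f₂ : ℂ → ℂ} {a₁ a₂ : ℕ → ℂ}
    (hf : HasComps f f₁ f₂)
    (h₁ : ∀ z : ℂ, ‖z‖ < 1 → HasSum (fun n => a₁ n * z ^ n) (f₁ z))
    (h₂ : ∀ z : ℂ, ‖z‖ < 1 → HasSum (fun n => a₂ n * z ^ n) (f₂ z))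
    (s₁ : Summable fun n => ‖a₁ n‖ ^ 2) (s₂ : Summable fun n => ‖a₂ n‖ ^ 2) :
    f ∈ H2 ∧ (normH2 f).fst = √(∑' n, ‖a₁ n‖ ^ 2) ∧ (normH2 f).snd = √(∑' n, ‖a₂ n‖ ^ 2) := by
  have hc : HasCoeffs f fun n => ofComp (a₁ n) (a₂ n) := by
    rw [hf.hasCoeffs_iff]
    simpa using ⟨h₁, h₂⟩
  have hs : HasSum (fun n => hypMod (coeff f n) ^ 2)
      (Hyp.ofIdem (∑' n, ‖a₁ n‖ ^ 2) (∑' n, ‖a₂ n‖ ^ 2)) := by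
    rw [Hyp.hasSum_iff, hc.coeff_eq]
    simp only [fst_hypMod_sq, snd_hypMod_sq, comp₁_ofComp, comp₂_ofComp, Hyp.fst_ofIdem,
      Hyp.snd_ofIdem]
    exact ⟨s₁.hasSum, s₂.hasSum⟩
  refine ⟨⟨hf.isBCHolomorphic (differentiableOn_of_hasSum h₁) (differentiableOn_of_hasSum h₂),
    hc.coeff_eq.symm ▸ hc, hs.summable⟩, ?_, ?_⟩
  · rw [normH2, Hyp.fst_sqrt, hs.tsum_eq, Hyp.fst_ofIdem]
  · rw [normH2, Hyp.snd_sqrt, hs.tsum_eq, Hyp.snd_ofIdem]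

/-! ## Composition operators -/

/-- The normalised reproducing kernel of the Hardy space at the point `a`. -/
theorem normalized_kernel {a : ℂ} (ha : ‖a‖ < 1) :
    (∀ z : ℂ, ‖z‖ < 1 → HasSum
      (fun n => ((√(1 - ‖a‖ ^ 2) : ℝ) : ℂ) * starRingEnd ℂ a ^ n * z ^ n)
      (((√(1 - ‖a‖ ^ 2) : ℝ) : ℂ) * (1 - starRingEnd ℂ a * z)⁻¹)) ∧
    HasSum (fun n => ‖((√(1 - ‖a‖ ^ 2) : ℝ) : ℂ) * starRingEnd ℂ a ^ n‖ ^ 2) 1 ∧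
    ‖((√(1 - ‖a‖ ^ 2) : ℝ) : ℂ) * (1 - starRingEnd ℂ a * a)⁻¹‖ = √((1 - ‖a‖ ^ 2)⁻¹) := by
  have ha2 : ‖a‖ ^ 2 < 1 := pow_lt_one₀ (norm_nonneg a) ha two_ne_zero
  have hpos : 0 < 1 - ‖a‖ ^ 2 := by linarith
  refine ⟨fun z hz => ?_, ?_, ?_⟩
  · have hlt : ‖starRingEnd ℂ a * z‖ < 1 := by
      rw [norm_mul, RCLike.norm_conj]
      exact mul_lt_one_of_nonneg_of_lt_one_left (norm_nonneg a) ha hz.le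
    refine ((hasSum_geometric_of_norm_lt_one hlt).mul_left _).congr_fun fun n => ?_
    rw [mul_pow, mul_assoc]
  · have h := (hasSum_geometric_of_lt_one (sq_nonneg ‖a‖) ha2).mul_left (1 - ‖a‖ ^ 2)
    rw [mul_inv_cancel₀ hpos.ne'] at h
    refine h.congr_fun fun n => ?_
    rw [norm_mul, norm_pow, RCLike.norm_conj, Complex.norm_real, Real.norm_eq_abs, mul_pow, sq_abs,
      Real.sq_sqrt hpos.le, ← pow_mul, ← pow_mul, mul_comm 2 n]
  · have e : 1 - starRingEnd ℂ a * a = ((1 - ‖a‖ ^ 2 : ℝ) : ℂ) := by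
      rw [Complex.conj_mul']
      push_cast
      ring
    rw [e, ← Complex.ofReal_inv, ← Complex.ofReal_mul, Complex.norm_real, Real.norm_eq_abs,
      abs_of_nonneg (by positivity), Real.sqrt_inv, ← div_eq_mul_inv, Real.sqrt_div_self]

theorem norm_le_sqrt_tsum {b : ℕ → ℂ} {F : ℂ → ℂ}
    (hb : ∀ z : ℂ, ‖z‖ < 1 → HasSum (fun n => b n * z ^ n) (F z))
    (hs : Summable fun n => ‖b n‖ ^ 2) : ‖F 0‖ ≤ √(∑' n, ‖b n‖ ^ 2) := by
  have h0 : F 0 = b 0 := by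
    refine (hb 0 (by simp)).unique ?_
    have := hasSum_single (f := fun n => b n * (0 : ℂ) ^ n) 0 fun n hn => by simp [hn]
    simpa using this
  rw [h0]
  exact Real.le_sqrt_of_sq_le (hs.le_tsum 0 fun _ _ => sq_nonneg _)

/-- The composition of an element of the Hardy space with a self-map of the unit disc, in
components. -/
theorem compOp_mem_H2 {Φ : unitDisc → unitDisc} {φ₁ φ₂ : ℂ → ℂ}
    (hΦ : HasComps (fun Z => (Φ Z : BC)) φ₁ φ₂)
    (d₁ : DifferentiableOn ℂ φ₁ (ball 0 1)) (d₂ : DifferentiableOn ℂ φ₂ (ball 0 1))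
    (m₁ : ∀ z : ℂ, ‖z‖ < 1 → ‖φ₁ z‖ < 1) (m₂ : ∀ z : ℂ, ‖z‖ < 1 → ‖φ₂ z‖ < 1)
    {f : unitDisc → BC} {f₁ f₂ : ℂ → ℂ} {a₁ a₂ : ℕ → ℂ} (hf : HasComps f f₁ f₂)
    (h₁ : ∀ z : ℂ, ‖z‖ < 1 → HasSum (fun n => a₁ n * z ^ n) (f₁ z))
    (h₂ : ∀ z : ℂ, ‖z‖ < 1 → HasSum (fun n => a₂ n * z ^ n) (f₂ z))
    (s₁ : Summable fun n => ‖a₁ n‖ ^ 2) (s₂ : Summable fun n => ‖a₂ n‖ ^ 2) :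
    compOp Φ f ∈ H2 ∧
      (normH2 (compOp Φ f)).fst ≤ √((1 + ‖φ₁ 0‖) / (1 - ‖φ₁ 0‖)) * √(∑' n, ‖a₁ n‖ ^ 2) ∧
      (normH2 (compOp Φ f)).snd ≤ √((1 + ‖φ₂ 0‖) / (1 - ‖φ₂ 0‖)) * √(∑' n, ‖a₂ n‖ ^ 2) ∧
      ‖f₁ (φ₁ 0)‖ ≤ (normH2 (compOp Φ f)).fst ∧ ‖f₂ (φ₂ 0)‖ ≤ (normH2 (compOp Φ f)).snd := by
  have hcomp : HasComps (compOp Φ f) (f₁ ∘ φ₁) (f₂ ∘ φ₂) := fun Z => by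
    have e : compOp Φ f Z = f (Φ Z) := rfl
    rw [e, (hf _).1, (hf _).2, (hΦ Z).1, (hΦ Z).2]
    exact ⟨rfl, rfl⟩
  have mapsTo : ∀ {φ : ℂ → ℂ}, (∀ z : ℂ, ‖z‖ < 1 → ‖φ z‖ < 1) →
      Set.MapsTo φ (ball 0 1) (ball 0 1) := fun h z hz => by
    rw [mem_ball_zero_iff] at hz ⊢
    exact h z hz
  obtain ⟨b₁, hb₁⟩ := exists_hasSum_of_differentiableOn
    ((differentiableOn_of_hasSum h₁).comp d₁ (mapsTo m₁))
  obtain ⟨b₂, hb₂⟩ := exists_hasSum_of_differentiableOn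
    ((differentiableOn_of_hasSum h₂).comp d₂ (mapsTo m₂))
  obtain ⟨t₁, l₁⟩ := littlewood_subordination h₁ s₁ d₁ m₁ hb₁
  obtain ⟨t₂, l₂⟩ := littlewood_subordination h₂ s₂ d₂ m₂ hb₂
  obtain ⟨hmem, n₁, n₂⟩ := hcomp.mem_H2 hb₁ hb₂ t₁ t₂
  have p₁ : 0 ≤ (1 + ‖φ₁ 0‖) / (1 - ‖φ₁ 0‖) :=
    div_nonneg (by positivity) (by linarith [m₁ 0 (by simp)])
  have p₂ : 0 ≤ (1 + ‖φ₂ 0‖) / (1 - ‖φ₂ 0‖) :=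
    div_nonneg (by positivity) (by linarith [m₂ 0 (by simp)])
  refine ⟨hmem, ?_, ?_, ?_, ?_⟩
  · rw [n₁, ← Real.sqrt_mul p₁]
    exact Real.sqrt_le_sqrt l₁
  · rw [n₂, ← Real.sqrt_mul p₂]
    exact Real.sqrt_le_sqrt l₂
  · rw [n₁]
    exact norm_le_sqrt_tsum hb₁ t₁
  · rw [n₂]
    exact norm_le_sqrt_tsum hb₂ t₂

end

end Bicomplex

/-! ### Assembly of boundedness and both norm estimates from the components -/

theorem corollary3p7 (Φ : Bicomplex.unitDisc → Bicomplex.unitDisc)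
    (hΦ : Bicomplex.IsBCHolomorphic (fun Z => (Φ Z : Bicomplex.BC))) :
    Bicomplex.IsDBounded (Bicomplex.compOp Φ) ∧
      ∃ N : Bicomplex.Hyp, Bicomplex.IsOpDNorm (Bicomplex.compOp Φ) N ∧
        Bicomplex.Hyp.sqrt ((1 - Bicomplex.hypMod (Φ 0 : Bicomplex.BC) ^ 2)⁻¹ʳ) ≤ N ∧
        N ≤ Bicomplex.Hyp.sqrt ((1 + Bicomplex.hypMod (Φ 0 : Bicomplex.BC)) *
          (1 - Bicomplex.hypMod (Φ 0 : Bicomplex.BC))⁻¹ʳ) := by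
  open Bicomplex in
  obtain ⟨φ₁, φ₂, d₁, d₂, hcomp⟩ := hΦ.exists_hasComps
  have h0 : ‖(0 : ℂ)‖ < 1 := by simp
  have m₁ : ∀ z : ℂ, ‖z‖ < 1 → ‖φ₁ z‖ < 1 := fun z hz => by
    have := (Φ (discPoint z 0)).2.1
    rwa [(hcomp _).1, coe_discPoint hz h0, comp₁_ofComp] at this
  have m₂ : ∀ z : ℂ, ‖z‖ < 1 → ‖φ₂ z‖ < 1 := fun z hz => by
    have := (Φ (discPoint 0 z)).2.2
    rwa [(hcomp _).2, coe_discPoint h0 hz, comp₂_ofComp] at this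
  have c₁ : comp₁ (Φ 0 : BC) = φ₁ 0 := by rw [(hcomp 0).1, coe_zero_unitDisc, map_zero]
  have c₂ : comp₂ (Φ 0 : BC) = φ₂ 0 := by rw [(hcomp 0).2, coe_zero_unitDisc, map_zero]
  have q₁ := m₁ 0 h0
  have q₂ := m₂ 0 h0
  set L := Hyp.sqrt ((1 - hypMod (Φ 0 : BC) ^ 2)⁻¹ʳ) with hL
  set M := Hyp.sqrt ((1 + hypMod (Φ 0 : BC)) * (1 - hypMod (Φ 0 : BC))⁻¹ʳ) with hM
  have f1 : (1 - hypMod (Φ 0 : BC)).fst = 1 - ‖φ₁ 0‖ := by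
    rw [← c₁, ← fst_hypMod, ← Hyp.fstHom_apply, map_sub, map_one]; rfl
  have f2 : (1 - hypMod (Φ 0 : BC)).snd = 1 - ‖φ₂ 0‖ := by
    rw [← c₂, ← snd_hypMod, ← Hyp.sndHom_apply, map_sub, map_one]; rfl
  have f3 : (1 + hypMod (Φ 0 : BC)).fst = 1 + ‖φ₁ 0‖ := by
    rw [← c₁, ← fst_hypMod, ← Hyp.fstHom_apply, map_add, map_one]; rfl
  have f4 : (1 + hypMod (Φ 0 : BC)).snd = 1 + ‖φ₂ 0‖ := by
    rw [← c₂, ← snd_hypMod, ← Hyp.sndHom_apply, map_add, map_one]; rfl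
  have f5 : (1 - hypMod (Φ 0 : BC) ^ 2).fst = 1 - ‖φ₁ 0‖ ^ 2 := by
    rw [← c₁, ← fst_hypMod_sq, ← Hyp.fstHom_apply, map_sub, map_one]; rfl
  have f6 : (1 - hypMod (Φ 0 : BC) ^ 2).snd = 1 - ‖φ₂ 0‖ ^ 2 := by
    rw [← c₂, ← snd_hypMod_sq, ← Hyp.sndHom_apply, map_sub, map_one]; rfl
  -- `⁻¹ʳ` is `0` off the units, so invertibility must be checked before the bounds are read
  -- componentwise.
  have u₁ : IsUnit (1 - hypMod (Φ 0 : BC)) :=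
    Hyp.isUnit_of_ne_zero (f1 ▸ (by linarith : 0 < 1 - ‖φ₁ 0‖).ne')
      (f2 ▸ (by linarith : 0 < 1 - ‖φ₂ 0‖).ne')
  have u₂ : IsUnit (1 - hypMod (Φ 0 : BC) ^ 2) :=
    Hyp.isUnit_of_ne_zero
      (f5 ▸ (sub_pos.2 (pow_lt_one₀ (norm_nonneg _) q₁ two_ne_zero)).ne')
      (f6 ▸ (sub_pos.2 (pow_lt_one₀ (norm_nonneg _) q₂ two_ne_zero)).ne')
  have M₁ : M.fst = √((1 + ‖φ₁ 0‖) / (1 - ‖φ₁ 0‖)) := by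
    rw [hM, Hyp.fst_sqrt, Hyp.fst_mul, Hyp.fst_inverse u₁, f1, f3, div_eq_mul_inv]
  have M₂ : M.snd = √((1 + ‖φ₂ 0‖) / (1 - ‖φ₂ 0‖)) := by
    rw [hM, Hyp.snd_sqrt, Hyp.snd_mul, Hyp.snd_inverse u₁, f2, f4, div_eq_mul_inv]
  have L₁ : L.fst = √((1 - ‖φ₁ 0‖ ^ 2)⁻¹) := by
    rw [hL, Hyp.fst_sqrt, Hyp.fst_inverse u₂, f5]
  have L₂ : L.snd = √((1 - ‖φ₂ 0‖ ^ 2)⁻¹) := by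
    rw [hL, Hyp.snd_sqrt, Hyp.snd_inverse u₂, f6]
  have fst_one : (1 : Hyp).fst = 1 := map_one Hyp.fstHom
  have snd_one : (1 : Hyp).snd = 1 := map_one Hyp.sndHom
  have hM0 : 0 ≤ M := by
    rw [Hyp.le_iff, M₁, M₂]
    exact ⟨(map_zero Hyp.fstHom).trans_le (Real.sqrt_nonneg _),
      (map_zero Hyp.sndHom).trans_le (Real.sqrt_nonneg _)⟩
  have bound : ∀ f ∈ H2, compOp Φ f ∈ H2 ∧ normH2 (compOp Φ f) ≤ M * normH2 f := by
    intro f hf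
    obtain ⟨f₁, f₂, a₁, a₂, hfc, h₁, h₂, s₁, s₂⟩ := exists_components_of_mem_H2 hf
    obtain ⟨-, n₁, n₂⟩ := hfc.mem_H2 h₁ h₂ s₁ s₂
    obtain ⟨hmem, l₁, l₂, -, -⟩ := compOp_mem_H2 hcomp d₁ d₂ m₁ m₂ hfc h₁ h₂ s₁ s₂
    refine ⟨hmem, Hyp.le_iff.2 ?_⟩
    rw [Hyp.fst_mul, Hyp.snd_mul, M₁, M₂, n₁, n₂]
    exact ⟨l₁, l₂⟩
  have hub : M ∈ upperBounds {α : Hyp | ∃ f ∈ H2, normH2 f ≤ 1 ∧ α = normH2 (compOp Φ f)} := by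
    rintro _ ⟨f, hf, hf1, rfl⟩
    refine (bound f hf).2.trans (Hyp.le_iff.2 ?_)
    have hf1 := Hyp.le_iff.1 hf1
    rw [fst_one, snd_one] at hf1
    rw [Hyp.fst_mul, Hyp.snd_mul]
    exact ⟨mul_le_of_le_one_right (M₁ ▸ Real.sqrt_nonneg _) hf1.1,
      mul_le_of_le_one_right (M₂ ▸ Real.sqrt_nonneg _) hf1.2⟩
  obtain ⟨k₁, t₁, v₁⟩ := normalized_kernel q₁
  obtain ⟨k₂, t₂, v₂⟩ := normalized_kernel q₂
  -- Unit kernels at `φ₁ 0` and `φ₂ 0`, joined into one bicomplex function, so that a single test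
  -- function yields both components of the lower bound.
  set g₁ : ℂ → ℂ := fun z =>
    ((√(1 - ‖φ₁ 0‖ ^ 2) : ℝ) : ℂ) * (1 - starRingEnd ℂ (φ₁ 0) * z)⁻¹
  set g₂ : ℂ → ℂ := fun z =>
    ((√(1 - ‖φ₂ 0‖ ^ 2) : ℝ) : ℂ) * (1 - starRingEnd ℂ (φ₂ 0) * z)⁻¹
  have hg : HasComps (fun Z => ofComp (g₁ (comp₁ Z)) (g₂ (comp₂ Z))) g₁ g₂ := fun Z =>
    ⟨comp₁_ofComp _ _, comp₂_ofComp _ _⟩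
  obtain ⟨hmem, n₁, n₂⟩ := hg.mem_H2 k₁ k₂ t₁.summable t₂.summable
  obtain ⟨-, -, -, w₁, w₂⟩ :=
    compOp_mem_H2 hcomp d₁ d₂ m₁ m₂ hg k₁ k₂ t₁.summable t₂.summable
  rw [t₁.tsum_eq, Real.sqrt_one] at n₁
  rw [t₂.tsum_eq, Real.sqrt_one] at n₂
  have hS : normH2 (compOp Φ fun Z => ofComp (g₁ (comp₁ Z)) (g₂ (comp₂ Z))) ∈
      {α : Hyp | ∃ f ∈ H2, normH2 f ≤ 1 ∧ α = normH2 (compOp Φ f)} :=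
    ⟨_, hmem, Hyp.le_iff.2 ⟨(n₁.trans fst_one.symm).le, (n₂.trans snd_one.symm).le⟩, rfl⟩
  have hlub := Hyp.isLUB_ofIdem ⟨_, hS⟩ ⟨M, hub⟩
  refine ⟨⟨fun f hf => (bound f hf).1, M, hM0, fun f hf => (bound f hf).2⟩, _, hlub, ?_,
    hlub.2 hub⟩
  refine le_trans (Hyp.le_iff.2 ?_) (hlub.1 hS)
  rw [L₁, L₂, ← v₁, ← v₂]
  exact ⟨w₁, w₂⟩
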